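/- Let $n,r\ge 1$ be integers. There exist a real constant $C$ and an integer $d$, depending only on $n$ and $r$, with the following property. Let $Q\subset\mathbb{R}^n$ be a closed cube (of positive side length, with sides parallel to the coordinate axes), and let $\mathcal{H}^0=(H^0_x)_{x\in Q}$ be any family of vector subspaces $H^0_x\subseteq\mathbb{R}^r$. Then there exist finite sets $S(x)\subset Q$ $(x\in Q)$, each containing at most $d$ points, and linear maps $A(x,y):\mathbb{R}^r\to\mathbb{R}^r$ $(x\in Q,\ y\in S(x))$, determined by $\mathcal{H}^0$ alone, such that the following holds. Let $(v(x))_{x\in Q}$ be any family of vectors in $\mathbb{R}^r$ with $v(x)\perp H^0_x$ for all $x\in Q$ (standard inner product), such that the family of affine subspaces $H_x=v(x)+H^0_x$ $(x\in Q)$ is Glaeser stable, i.e. it equals its own Glaeser refinement: for every $x\in Q$, $$H_x=\{p\in H_x:\ \operatorname{dist}(p,H_y)\to 0\ \text{ as } y\to x,\ y\in Q\}.$$ Then the function $$F(x)=\sum_{y\in S(x)}A(x,y)\,v(y)\qquad(x\in Q)$$ is a section of $(H_x)_{x\in Q}$, that is, $F:Q\to\mathbb{R}^r$ is continuous and $F(x)\in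 v(x)+H^0_x$ for every $x\in Q$. Moreover $\sup_{x\in Q}|v(x)|<\infty$ and $$\max_{x\in Q}|F(x)|\le C\,\sup_{x\in Q}|v(x)|.$$ -/

import Mathlib

/-- A singular affine bundle over `X`: a family of affine subspaces of `ℝ^r`
(`⊥`, the empty affine subspace, is allowed as a fiber). -/
abbrev SingularAffineBundle (X : Type*) (r : ℕ) : Type _ :=
  X → AffineSubspace ℝ (EuclideanSpace ℝ (Fin r))

/-- A homogeneous bundle over `X`: a family of vector subspaces of `ℝ^r`. -/
abbrev HomogeneousBundle (X : Type*) (r : ℕ) : Type _ :=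
  X → Submodule ℝ (EuclideanSpace ℝ (Fin r))

namespace SingularAffineBundle

variable {X : Type*} {r : ℕ}

/-- The bundle `(v(x) + H⁰_x)_{x ∈ X}`. -/
noncomputable def translate (v : X → EuclideanSpace ℝ (Fin r)) (H₀ : HomogeneousBundle X r) :
    SingularAffineBundle X r :=
  fun x => AffineSubspace.mk' (v x) (H₀ x)

theorem infEDist_combination_le (K : AffineSubspace ℝ (EuclideanSpace ℝ (Fin r))) (t : ℝ)
    (a b c : EuclideanSpace ℝ (Fin r)) :
    Metric.infEDist (t • (a - b) + c) (K : Set (EuclideanSpace ℝ (Fin r))) ≤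
      (‖t‖₊ : ENNReal) * (Metric.infEDist a K + Metric.infEDist b K) + Metric.infEDist c K := by
  rcases (K : Set (EuclideanSpace ℝ (Fin r))).eq_empty_or_nonempty with h | ⟨p, hp⟩
  · simp [h]
  · have hne : (K : Set (EuclideanSpace ℝ (Fin r))).Nonempty := ⟨p, hp⟩
    refine ENNReal.le_of_forall_pos_le_add fun ε hε _ => ?_
    set δ : NNReal := ε / (2 * ‖t‖₊ + 1) with hδ
    have hδ0 : (δ : ENNReal) ≠ 0 := by
      have : 0 < δ := by positivity
      exact_mod_cast this.ne'
    have key : ∀ z : EuclideanSpace ℝ (Fin r),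
        ∃ w ∈ (K : Set (EuclideanSpace ℝ (Fin r))), edist z w < Metric.infEDist z K + δ :=
      fun z => Metric.infEDist_lt_iff.1
        (ENNReal.lt_add_right (Metric.infEDist_ne_top hne) hδ0)
    obtain ⟨a', ha', hda⟩ := key a
    obtain ⟨b', hb', hdb⟩ := key b
    obtain ⟨c', hc', hdc⟩ := key c
    have hmem : t • (a' - b') + c' ∈ (K : Set (EuclideanSpace ℝ (Fin r))) := by
      simpa using K.smul_vsub_vadd_mem t ha' hb' hc'
    have hεδ : (ε : ENNReal) = (‖t‖₊ : ENNReal) * (δ + δ) + δ := by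
      have : ε = ‖t‖₊ * (δ + δ) + δ := by
        rw [hδ]; field_simp; ring
      exact_mod_cast this
    calc Metric.infEDist (t • (a - b) + c) K
        ≤ edist (t • (a - b) + c) (t • (a' - b') + c') := Metric.infEDist_le_edist_of_mem hmem
      _ ≤ edist (t • (a - b)) (t • (a' - b')) + edist c c' := edist_add_add_le _ _ _ _
      _ ≤ (‖t‖₊ : ENNReal) * (edist a a' + edist b b') + edist c c' := by
          gcongr
          rw [edist_smul₀, ENNReal.smul_def, smul_eq_mul]
          gcongr
          simpa [sub_eq_add_neg, edist_neg_neg] using edist_add_add_le a (-b) a' (-b')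
      _ ≤ (‖t‖₊ : ENNReal) * ((Metric.infEDist a K + δ) + (Metric.infEDist b K + δ))
            + (Metric.infEDist c K + δ) := by gcongr
      _ = _ := by rw [hεδ]; ring

/-- The Glaeser refinement: the fiber at `x` is the set of `p ∈ H_x` with
`dist(p, H_y) → 0` as `y → x`. The distance is `[0, ∞]`-valued, so that the distance to an
empty fiber is `∞`. -/
noncomputable def glaeserRefinement [TopologicalSpace X] (H : SingularAffineBundle X r) :
    SingularAffineBundle X r := fun x =>
  { carrier := {p | p ∈ H x ∧
      Filter.Tendsto (fun y => Metric.infEDist p (H y : Set (EuclideanSpace ℝ (Fin r))))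
        (nhds x) (nhds 0)}
    smul_vsub_vadd_mem' := by
      rintro t a b c ⟨ha, hda⟩ ⟨hb, hdb⟩ ⟨hc, hdc⟩
      refine ⟨(H x).smul_vsub_vadd_mem t ha hb hc, ?_⟩
      have h := (ENNReal.Tendsto.const_mul (hda.add hdb)
        (Or.inr (ENNReal.coe_ne_top (r := ‖t‖₊)))).add hdc
      simp only [add_zero, mul_zero] at h
      exact tendsto_of_tendsto_of_tendsto_of_le_of_le tendsto_const_nhds h
        (fun _ => zero_le) (fun y => infEDist_combination_le (H y) t a b c) }

/-- A bundle is Glaeser stable if it is its own Glaeser refinement. -/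
def IsGlaeserStable [TopologicalSpace X] (H : SingularAffineBundle X r) : Prop :=
  H.glaeserRefinement = H

/-- A section of a bundle: a continuous map with values in the fibers. -/
def IsSection [TopologicalSpace X] (H : SingularAffineBundle X r)
    (f : X → EuclideanSpace ℝ (Fin r)) : Prop :=
  Continuous f ∧ ∀ x, f x ∈ H x

end SingularAffineBundle

/-- The closed cube in `ℝ^n` with center `c`, side length `δ`, and sides parallel to the
coordinate axes. -/
def closedCube {n : ℕ} (c : EuclideanSpace ℝ (Fin n)) (δ : ℝ) :
    Set (EuclideanSpace ℝ (Fin n)) :=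
  {x | ∀ i, |x i - c i| ≤ δ / 2}

/-!
Glaeser stability makes the bundle `v x + H x` lower semicontinuous: each point `p` of a fiber is
the limit of its projections to the neighboring fibers. Hence `{x | dim (H x) < k}` is closed, and
over the points `x` with `dim (H x) = k`, the vector `v x` and the projection to `H x` vary
continuously.

A section over `{x | dim (H x) < k}` extends to `{x | dim (H x) ≤ k}` as follows. Extend it to a
continuous function `F` on the whole space by averaging its values with a Whitney partition of
unity, of overlap bounded by the doubling constant `N`, and then project `F x` to the fiber at `x`.
The projection moves nothing over the lower strata, and it preserves continuity by lower
semicontinuity there and by the continuity of the projections at the points where the dimension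
equals `k`. Each extension is linear in `v`, evaluates, at each point, `v` once and the previous
section at most `N` times, and adds at most `sup ‖v‖` to the norm; after `r + 1` extensions all
dimensions are exhausted. Finally `v` is bounded since `v x` is the shortest vector of its fiber,
hence no longer than the value at `x` of the continuous section just constructed.
-/

open Filter Topology Metric Module
open scoped NNReal Finset

section Doubling

variable {X Y : Type*} [PseudoMetricSpace X] [PseudoMetricSpace Y] {N : ℕ}

/-- The metric doubling property with constant `N`: a ball of radius `2 * a` contains at most `N`
points at mutual distances greater than `a`. It bounds the overlap of Whitney covers. -/
def IsDoublingWith (X : Type*) [PseudoMetricSpace X] (N : ℕ) : Prop :=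
  ∀ (x : X) (a : ℝ≥0), 0 < a → packingNumber a (closedBall x (2 * a)) ≤ N

theorem IsDoublingWith.one_le [Nonempty X] (hX : IsDoublingWith X N) : 1 ≤ N := by
  obtain ⟨x⟩ := ‹Nonempty X›
  have hpos : 0 < packingNumber 1 (closedBall x (2 * (1 : ℝ≥0))) :=
    packingNumber_pos_iff.2 ⟨x, mem_closedBall_self (by positivity)⟩
  exact_mod_cast hpos.trans_le (hX x 1 one_pos)

theorem IsDoublingWith.of_isometry (hY : IsDoublingWith Y N) {f : X → Y} (hf : Isometry f) :
    IsDoublingWith X N := by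
  refine fun x a ha => iSup_le fun C => iSup₂_le fun hC hsep => ?_
  have hdist : C.Pairwise fun x y => a < edist (f x) (f y) := by
    simpa only [IsSeparated, hf.edist_eq] using hsep
  have hinj : C.InjOn f := fun x hx y hy hxy => by
    by_contra hne
    simpa [hxy] using hdist hx hy hne
  have hball : f '' C ⊆ closedBall (f x) (2 * a) :=
    Set.image_subset_iff.2 fun y hy => hf.mapsTo_closedBall x _ (hC hy)
  rw [← hinj.encard_image]
  exact (IsSeparated.encard_le_packingNumber hball (hinj.pairwise_image.2 hdist)).trans
    (hY (f x) a ha)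

theorem IsDoublingWith.subtype (hX : IsDoublingWith X N) (s : Set X) : IsDoublingWith s N :=
  hX.of_isometry isometry_subtype_coe

theorem isDoublingWith_five_pow_finrank (V : Type*) [NormedAddCommGroup V] [NormedSpace ℝ V]
    [FiniteDimensional ℝ V] : IsDoublingWith V (5 ^ finrank ℝ V) := by
  classical
  intro x a ha
  refine iSup_le fun C => iSup₂_le fun hC hsep => ?_
  by_contra! hcard
  obtain ⟨t, htC, ht⟩ := Set.exists_subset_encard_eq (Order.add_one_le_of_lt hcard)
  lift t to Finset V using
    Set.finite_of_encard_eq_coe (k := 5 ^ finrank ℝ V + 1) (by simpa using ht)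
  have ha' : (0 : ℝ) < a := ha
  let rescale : V → V := fun p => (a : ℝ)⁻¹ • (p - x)
  have hrescale : ∀ p q, rescale p - rescale q = (a : ℝ)⁻¹ • (p - q) := fun p q => by
    simp [rescale, ← smul_sub]
  have hinj : Function.Injective rescale := fun p q hpq =>
    sub_left_injective (smul_right_injective V (inv_ne_zero ha'.ne') hpq)
  have hbound : #(t.image rescale) ≤ 5 ^ finrank ℝ V := by
    refine Besicovitch.card_le_of_separated _ (Finset.forall_mem_image.2 fun p hp => ?_)
      (Finset.forall_mem_image.2 fun p hp => Finset.forall_mem_image.2 fun q hq hpq => ?_)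
    · have hpx : ‖p - x‖ ≤ 2 * a := mem_closedBall_iff_norm.1 (hC (htC hp))
      rw [norm_smul, norm_inv, NNReal.norm_eq, inv_mul_le_iff₀ ha']
      linarith
    · have hlt : (a : ENNReal) < edist p q := hsep (htC hp) (htC hq) (ne_of_apply_ne rescale hpq)
      have hpq' : (a : ℝ) < ‖p - q‖ := by
        rw [← dist_eq_norm, dist_nndist]
        rw [edist_nndist] at hlt
        exact_mod_cast hlt
      rw [hrescale, norm_smul, norm_inv, NNReal.norm_eq, le_inv_mul_iff₀ ha']
      linarith
  rw [Finset.card_image_of_injective t hinj] at hbound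
  rw [Set.encard_coe_eq_coe_finsetCard] at ht
  have : #t = 5 ^ finrank ℝ V + 1 := by exact_mod_cast ht
  omega

end Doubling

section Whitney

variable {X : Type*} [PseudoMetricSpace X] {N : ℕ}

theorem exists_maximal_separated (σ : X → ℝ) (hσ : ∀ x, 0 < σ x) :
    ∃ P : Set X, (P.Pairwise fun p q => max (σ p) (σ q) ≤ dist p q) ∧
      ∀ x, ∃ p ∈ P, dist x p < max (σ x) (σ p) := by
  obtain ⟨P, hP⟩ := zorn_subset
    {P : Set X | P.Pairwise fun p q => max (σ p) (σ q) ≤ dist p q}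
    fun c hc hchain => ⟨⋃₀ c, (Set.pairwise_sUnion hchain.directedOn).2 hc,
      fun _ => Set.subset_sUnion_of_mem⟩
  refine ⟨P, hP.prop, fun x => ?_⟩
  by_contra! hfar
  have hxP : x ∈ P := by
    refine hP.le_of_ge (hP.prop.insert fun p hp _ => ⟨hfar p hp, ?_⟩) (Set.subset_insert x P)
      (Set.mem_insert x P)
    rw [max_comm, dist_comm]
    exact hfar p hp
  have := hfar x hxP
  rw [max_self, dist_self] at this
  exact this.not_gt (hσ x)

theorem IsDoublingWith.exists_whitney_cover (hX : IsDoublingWith X N) {ρ : X → ℝ}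
    (hρ : ∀ x, 0 < ρ x) (hlip : LipschitzWith 1 ρ) :
    ∃ P : Set X, (∀ x, ∃ p : P, x ∈ ball (p : X) (ρ p / 7)) ∧
      ∀ x, {p : P | (ball (p : X) (ρ p / 7) ∩ ball x (ρ x / 100)).Nonempty}.encard ≤ N := by
  have hρ_le : ∀ x y, ρ x ≤ ρ y + dist x y := fun x y => by
    simpa using hlip.le_add_mul x y
  obtain ⟨P, hsep, hnear⟩ := exists_maximal_separated (fun x => ρ x / 8)
    fun x => div_pos (hρ x) (by norm_num)
  refine ⟨P, fun x => ?_, fun x => ?_⟩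
  · obtain ⟨p, hp, hxp⟩ := hnear x
    refine ⟨⟨p, hp⟩, mem_ball.2 ?_⟩
    have := hρ_le x p
    have := hρ p
    rcases lt_max_iff.1 hxp with h | h <;> linarith
  · set A := {p : P | (ball (p : X) (ρ p / 7) ∩ ball x (ρ x / 100)).Nonempty}
    -- If `ball p (ρ p / 7)` meets `ball x (ρ x / 100)`, then `ρ p > 3 / 4 * ρ x`, so such `p`
    -- are at mutual distances at least `ρ p / 8 > a`.
    let a : ℝ≥0 := ⟨3 / 32 * ρ x, by linarith [hρ x]⟩
    have ha : (a : ℝ) = 3 / 32 * ρ x := rfl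
    have hcomparable : ∀ p ∈ A, dist (p : X) x ≤ 2 * a ∧ a < ρ p / 8 := by
      rintro p ⟨z, hzp, hzx⟩
      rw [mem_ball] at hzp hzx
      have := hρ_le p z
      have := hρ_le z p
      have := hρ_le z x
      have := hρ_le x z
      have := dist_triangle (p : X) z x
      have := dist_comm (p : X) z
      have := dist_comm x z
      constructor <;> linarith
    have hA_sep : IsSeparated a (Subtype.val '' A) := by
      refine (Subtype.val_injective.injOn.pairwise_image).2 fun p hp q _ hpq => ?_
      have hlt : (a : ℝ) < dist (p : X) q := (hcomparable p hp).2.trans_le <|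
        (le_max_left _ _).trans (hsep p.2 q.2 (Subtype.coe_ne_coe.2 hpq))
      rw [dist_nndist] at hlt
      rw [Function.onFun, edist_nndist]
      exact_mod_cast hlt
    have hA_ball : Subtype.val '' A ⊆ closedBall x (2 * a) :=
      Set.image_subset_iff.2 fun p hp => (hcomparable p hp).1
    rw [← Subtype.val_injective.encard_image]
    exact (hA_sep.encard_le_packingNumber hA_ball).trans
      (hX x a (show (0 : ℝ) < a by linarith [hρ x]))

/-- A Whitney partition of unity on the complement of `E`: every index `i` has an anchor in `E`
that is about as close as possible to the support of the `i`-th function. -/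
structure WhitneyPartition (ι : Type*) (E : Set X) where
  /-- The functions, which live on the subspace `Eᶜ`. -/
  toPartition : PartitionOfUnity ι (Eᶜ : Set X)
  /-- The points of `E` at which an extension to `Eᶜ` samples a function on `E`. -/
  anchor : ι → X
  anchor_mem : ∀ i, anchor i ∈ E
  dist_anchor_le : ∀ i x, toPartition i x ≠ 0 → dist (x : X) (anchor i) ≤ 3 * infDist (x : X) E

theorem IsDoublingWith.exists_whitneyPartition (hX : IsDoublingWith X N) {E : Set X}
    (hE : IsClosed E) (hne : E.Nonempty) :
    ∃ (P : Set (Eᶜ : Set X)) (φ : WhitneyPartition P E),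
      ∀ x, #(φ.toPartition.finsupport x) ≤ N := by
  let ρ : (Eᶜ : Set X) → ℝ := fun x => infDist (x : X) E
  have hρ : ∀ x, 0 < ρ x := fun x => (hE.notMem_iff_infDist_pos hne).1 x.2
  have hlip : LipschitzWith 1 ρ := .of_le_add fun _ _ => infDist_le_infDist_add_dist
  obtain ⟨P, hcover, hoverlap⟩ := (hX.subtype Eᶜ).exists_whitney_cover hρ hlip
  let U : P → Set (Eᶜ : Set X) := fun p => ball (p : (Eᶜ : Set X)) (ρ p / 7)
  have hU : LocallyFinite U := fun x => ⟨ball x (ρ x / 100), ball_mem_nhds x (by linarith [hρ x]),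
    Set.finite_of_encard_le_coe (hoverlap x)⟩
  obtain ⟨φ, hφ⟩ := PartitionOfUnity.exists_isSubordinate_of_locallyFinite isClosed_univ U
    (fun _ => isOpen_ball) hU fun x _ => Set.mem_iUnion.2 (hcover x)
  have hφU : ∀ p x, φ p x ≠ 0 → x ∈ U p := fun p x hpx => hφ p (subset_tsupport _ hpx)
  have hanchor : ∀ p : P, ∃ y ∈ E, dist (p : X) y < 2 * ρ p := fun p =>
    (infDist_lt_iff hne).1 (show ρ p < 2 * ρ p by linarith [hρ p])
  choose π hπE hπ using hanchor
  refine ⟨P, ⟨φ, π, hπE, fun p x hpx => ?_⟩, fun x => ?_⟩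
  · have hxp : dist (x : X) p < ρ p / 7 := hφU p x hpx
    have hpx' : ρ p ≤ ρ x + dist (p : X) x := infDist_le_infDist_add_dist
    rw [dist_comm] at hpx'
    change _ ≤ 3 * ρ x
    linarith [dist_triangle (x : X) p (π p), hπ p, hρ x]
  · have hsub : (φ.finsupport x : Set P) ⊆ {p | (U p ∩ ball x (ρ x / 100)).Nonempty} :=
      fun p hp => ⟨x, hφU p x ((φ.mem_finsupport x).1 hp), mem_ball_self (by linarith [hρ x])⟩
    have := (Set.encard_le_encard hsub).trans (hoverlap x)
    rwa [Set.encard_coe_eq_coe_finsetCard, Nat.cast_le] at this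

namespace WhitneyPartition

variable {ι : Type*} {E : Set X} (φ : WhitneyPartition ι E)
variable {W : Type*} [NormedAddCommGroup W] [NormedSpace ℝ W] {g : X → W} {a x : X}

open scoped Classical in
/-- The weights with which the extension of a function from `E` to `X` averages, at the point `x`,
its values on `E`. -/
noncomputable def weights (x : X) : X →₀ ℝ :=
  if hx : x ∈ E then Finsupp.single x 1
  else (Finsupp.onFinset (φ.toPartition.finsupport ⟨x, hx⟩) (fun i => φ.toPartition i ⟨x, hx⟩)
    fun _ hi => (φ.toPartition.mem_finsupport _).2 hi).mapDomain φ.anchor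

theorem weights_of_mem (hx : x ∈ E) : φ.weights x = Finsupp.single x 1 :=
  dif_pos hx

theorem card_support_weights_le {N : ℕ} (hN : 1 ≤ N)
    (hφ : ∀ x, #(φ.toPartition.finsupport x) ≤ N) (x : X) : #(φ.weights x).support ≤ N := by
  classical
  by_cases hx : x ∈ E
  · rw [weights_of_mem φ hx]
    exact (Finset.card_le_card Finsupp.support_single_subset).trans hN
  · rw [weights, dif_neg hx]
    calc _ ≤ _ := Finset.card_le_card Finsupp.mapDomain_support
      _ ≤ _ := Finset.card_image_le
      _ ≤ #(φ.toPartition.finsupport ⟨x, hx⟩) := Finset.card_le_card Finsupp.support_onFinset_subset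
      _ ≤ N := hφ _

variable (g) in
theorem linearCombination_weights_of_notMem (hx : x ∉ E) :
    Finsupp.linearCombination ℝ g (φ.weights x) =
      ∑ᶠ i, φ.toPartition i ⟨x, hx⟩ • g (φ.anchor i) := by
  rw [weights, dif_neg hx, Finsupp.linearCombination_mapDomain, Finsupp.linearCombination_onFinset]
  exact φ.toPartition.sum_finsupport_smul_eq_finsum fun i _ => g (φ.anchor i)

theorem linearCombination_weights_mem_of_convex {t : Set W} (ht : Convex ℝ t)
    (hg : ∀ e ∈ E, dist x e ≤ 3 * infDist x E → g e ∈ t) :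
    Finsupp.linearCombination ℝ g (φ.weights x) ∈ t := by
  by_cases hx : x ∈ E
  · rw [weights_of_mem φ hx, Finsupp.linearCombination_single, one_smul]
    exact hg x hx (by rw [dist_self, infDist_zero_of_mem hx, mul_zero])
  · rw [linearCombination_weights_of_notMem φ g hx]
    exact φ.toPartition.finsum_smul_mem_convex (g := fun i _ => g (φ.anchor i)) (Set.mem_univ _)
      (fun i hi => hg _ (φ.anchor_mem i) (φ.dist_anchor_le i _ hi)) ht

theorem continuousOn_compl_linearCombination_weights :
    ContinuousOn (fun x => Finsupp.linearCombination ℝ g (φ.weights x)) Eᶜ := by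
  rw [continuousOn_iff_continuous_domRestrict]
  refine (φ.toPartition.continuous_finsum_smul (g := fun i _ => g (φ.anchor i))
    fun _ _ _ => continuousAt_const).congr fun x => ?_
  exact (linearCombination_weights_of_notMem φ g x.2).symm

theorem continuousAt_linearCombination_weights (ha : a ∈ E) (hg : ContinuousWithinAt g E a) :
    ContinuousAt (fun x => Finsupp.linearCombination ℝ g (φ.weights x)) a := by
  have hval : Finsupp.linearCombination ℝ g (φ.weights a) = g a := by
    rw [weights_of_mem φ ha, Finsupp.linearCombination_single, one_smul]
  refine Metric.continuousAt_iff.2 fun ε hε => ?_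
  obtain ⟨δ, hδ, hgδ⟩ := Metric.continuousWithinAt_iff.1 hg ε hε
  refine ⟨δ / 4, by positivity, fun {x} hxa => ?_⟩
  rw [hval]
  refine φ.linearCombination_weights_mem_of_convex (convex_ball (g a) ε) fun e he hxe => ?_
  have hinf : infDist x E ≤ dist x a := infDist_le_dist_of_mem ha
  refine hgδ he ?_
  linarith [dist_triangle_left e a x]

theorem continuous_linearCombination_weights (hE : IsClosed E) (hg : ContinuousOn g E) :
    Continuous fun x => Finsupp.linearCombination ℝ g (φ.weights x) := by
  refine continuous_iff_continuousAt.2 fun x => ?_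
  by_cases hx : x ∈ E
  · exact φ.continuousAt_linearCombination_weights hx (hg x hx)
  · exact φ.continuousOn_compl_linearCombination_weights.continuousAt (hE.isOpen_compl.mem_nhds hx)

theorem norm_linearCombination_weights_le {B : ℝ} (hg : ∀ x ∈ E, ‖g x‖ ≤ B) (x : X) :
    ‖Finsupp.linearCombination ℝ g (φ.weights x)‖ ≤ B :=
  mem_closedBall_zero_iff.1 <| φ.linearCombination_weights_mem_of_convex (convex_closedBall 0 B)
    fun e he _ => mem_closedBall_zero_iff.2 (hg e he)

end WhitneyPartition

theorem IsDoublingWith.exists_weights (W : Type*) [NormedAddCommGroup W] [NormedSpace ℝ W]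
    (hX : IsDoublingWith X N) {E : Set X} (hE : IsClosed E) :
    ∃ w : X → X →₀ ℝ, (∀ x, #(w x).support ≤ N) ∧ (∀ x ∈ E, w x = Finsupp.single x 1) ∧
      (∀ g : X → W, ContinuousOn g E →
        Continuous fun x => Finsupp.linearCombination ℝ g (w x)) ∧
      ∀ (g : X → W) (B : ℝ), 0 ≤ B → (∀ x ∈ E, ‖g x‖ ≤ B) →
        ∀ x, ‖Finsupp.linearCombination ℝ g (w x)‖ ≤ B := by
  rcases E.eq_empty_or_nonempty with rfl | hne
  · exact ⟨0, by simp, by simp, fun g _ => by simpa using continuous_const,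
      fun g B hB _ x => by simpa using hB⟩
  have : Nonempty X := hne.to_type
  obtain ⟨P, φ, hφ⟩ := hX.exists_whitneyPartition hE hne
  exact ⟨φ.weights, φ.card_support_weights_le hX.one_le hφ, fun x => φ.weights_of_mem,
    fun g => φ.continuous_linearCombination_weights hE,
    fun g B _ => φ.norm_linearCombination_weights_le⟩

end Whitney

section AffineProj

variable {W : Type*} [NormedAddCommGroup W] [InnerProductSpace ℝ W]
variable (K : Submodule ℝ W) [K.HasOrthogonalProjection] {u p q : W}

/-- The orthogonal projection of `p` to the affine subspace `u + K`, provided that `u` is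
orthogonal to `K`. The formula is linear in the pair `(u, p)`. -/
noncomputable def affineProj (u p : W) : W :=
  u + K.starProjection p

variable {K}

theorem affineProj_sub_mem : affineProj K u p - u ∈ K := by
  rw [affineProj, add_sub_cancel_left]
  exact K.starProjection_apply_mem p

theorem affineProj_eq_self (hu : u ∈ Kᗮ) (hp : p - u ∈ K) : affineProj K u p = p := by
  rw [affineProj, K.eq_starProjection_of_mem_orthogonal hp (by rwa [sub_sub_cancel]),
    add_sub_cancel]

variable (K u) in
theorem dist_affineProj_affineProj_le (p q : W) :
    dist (affineProj K u p) (affineProj K u q) ≤ dist p q := by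
  rw [affineProj, affineProj, dist_add_left]
  exact K.lipschitzWith_starProjection.dist_le_mul_of_le le_rfl |>.trans_eq (one_mul _)

theorem dist_self_affineProj_le (hu : u ∈ Kᗮ) (hq : q - u ∈ K) (p : W) :
    dist p (affineProj K u p) ≤ dist p q := by
  have hKq : K.starProjection q = q - u := eq_sub_of_add_eq' (affineProj_eq_self hu hq)
  have hproj : p - affineProj K u p = Kᗮ.starProjection (p - q) := by
    rw [K.starProjection_orthogonal_val, map_sub, hKq, affineProj]
    abel
  rw [dist_eq_norm, dist_eq_norm, hproj]
  exact Kᗮ.norm_starProjection_apply_le _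

theorem norm_le_of_sub_mem (hu : u ∈ Kᗮ) (hp : p - u ∈ K) : ‖u‖ ≤ ‖p‖ := by
  have hproj : Kᗮ.starProjection p = u :=
    Kᗮ.eq_starProjection_of_mem_orthogonal hu (K.le_orthogonal_orthogonal hp)
  exact hproj ▸ Kᗮ.norm_starProjection_apply_le p

end AffineProj

section Lsc

variable {W : Type*} [NormedAddCommGroup W] [InnerProductSpace ℝ W] [FiniteDimensional ℝ W]

theorem trace_starProjection (K : Submodule ℝ W) :
    LinearMap.trace ℝ W (K.starProjection : W →ₗ[ℝ] W) = finrank ℝ K :=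
  LinearMap.IsProj.trace ⟨K.starProjection_apply_mem, fun _ => K.starProjection_eq_self_iff.2⟩

theorem sum_norm_starProjection_sub_sq {ι : Type*} [Fintype ι] (b : OrthonormalBasis ι ℝ W)
    (K L : Submodule ℝ W) :
    ∑ i, ‖K.starProjection (b i) - L.starProjection (b i)‖ ^ 2 =
      finrank ℝ K + finrank ℝ L - 2 * ∑ i, inner ℝ (b i) (K.starProjection (L.starProjection (b i)))
    := by
  have hsq : ∀ (M : Submodule ℝ W) (e : W), ‖M.starProjection e‖ ^ 2 =
      inner ℝ e (M.starProjection e) := fun M e => by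
    rw [← real_inner_self_eq_norm_sq, M.inner_starProjection_left_eq_right,
      M.starProjection_eq_self_iff.2 (M.starProjection_apply_mem e)]
  rw [← trace_starProjection K, ← trace_starProjection L, LinearMap.trace_eq_sum_inner _ b,
    LinearMap.trace_eq_sum_inner _ b, ← Finset.sum_add_distrib, Finset.mul_sum,
    ← Finset.sum_sub_distrib]
  refine Finset.sum_congr rfl fun i _ => ?_
  rw [norm_sub_sq_real, hsq, hsq, K.inner_starProjection_left_eq_right]
  simp only [ContinuousLinearMap.coe_coe]
  ring

variable {Y ι : Type*} [TopologicalSpace Y] [Fintype ι] {H : Y → Submodule ℝ W} {v : Y → W}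
  {x : Y} {l : Filter Y}

/-- A family of subspaces is lower semicontinuous if every vector of a fiber is the limit of its
projections to the neighboring fibers. -/
def IsLscFamily (H : Y → Submodule ℝ W) : Prop :=
  ∀ x, ∀ h ∈ H x, Tendsto (fun y => (H y).starProjection h) (𝓝 x) (𝓝 h)

namespace IsLscFamily

theorem tendsto_sum_inner (hH : IsLscFamily H) (x : Y) (b : OrthonormalBasis ι ℝ W) :
    Tendsto (fun y => ∑ i, inner ℝ (b i) ((H y).starProjection ((H x).starProjection (b i))))
      (𝓝 x) (𝓝 (finrank ℝ (H x))) := by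
  rw [← trace_starProjection (H x), LinearMap.trace_eq_sum_inner _ b]
  exact tendsto_finsetSum _ fun i _ =>
    tendsto_const_nhds.inner (hH x _ ((H x).starProjection_apply_mem _))

theorem eventually_finrank_le (hH : IsLscFamily H) (x : Y) :
    ∀ᶠ y in 𝓝 x, finrank ℝ (H x) ≤ finrank ℝ (H y) := by
  let b := stdOrthonormalBasis ℝ W
  have hlt : (finrank ℝ (H x) : ℝ) - 1 / 2 < finrank ℝ (H x) := by linarith
  filter_upwards [(hH.tendsto_sum_inner x b).eventually_const_lt hlt] with y hy
  have hnonneg : 0 ≤ ∑ i, ‖(H y).starProjection (b i) - (H x).starProjection (b i)‖ ^ 2 := by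
    positivity
  rw [sum_norm_starProjection_sub_sq] at hnonneg
  have : (finrank ℝ (H x) : ℝ) < finrank ℝ (H y) + 1 := by linarith
  exact Nat.lt_succ_iff.1 (by exact_mod_cast this)

theorem isClosed_finrank_lt (hH : IsLscFamily H) (k : ℕ) : IsClosed {x | finrank ℝ (H x) < k} := by
  refine isOpen_compl_iff.1 (isOpen_iff_mem_nhds.2 fun x hx => ?_)
  filter_upwards [hH.eventually_finrank_le x] with y hy
  exact fun hyk => hx (hy.trans_lt hyk)

theorem tendsto_sum_norm_starProjection_sub_sq (hH : IsLscFamily H) (hl : l ≤ 𝓝 x)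
    (hrank : ∀ᶠ y in l, finrank ℝ (H y) ≤ finrank ℝ (H x)) (b : OrthonormalBasis ι ℝ W) :
    Tendsto (fun y => ∑ i, ‖(H y).starProjection (b i) - (H x).starProjection (b i)‖ ^ 2)
      l (𝓝 0) := by
  have hlim := (((hH.tendsto_sum_inner x b).mono_left hl).const_mul 2).const_sub
    (2 * (finrank ℝ (H x) : ℝ))
  rw [sub_self] at hlim
  refine squeeze_zero' (.of_forall fun y => by positivity) ?_ hlim
  filter_upwards [hrank] with y hy
  rw [sum_norm_starProjection_sub_sq]
  have : (finrank ℝ (H y) : ℝ) ≤ finrank ℝ (H x) := by exact_mod_cast hy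
  linarith

theorem tendsto_starProjection (hH : IsLscFamily H) (hl : l ≤ 𝓝 x)
    (hrank : ∀ᶠ y in l, finrank ℝ (H y) ≤ finrank ℝ (H x)) (u : W) :
    Tendsto (fun y => (H y).starProjection u) l (𝓝 ((H x).starProjection u)) := by
  let b := stdOrthonormalBasis ℝ W
  have hsum := hH.tendsto_sum_norm_starProjection_sub_sq hl hrank b
  have hbasis : ∀ i, Tendsto (fun y => (H y).starProjection (b i)) l
      (𝓝 ((H x).starProjection (b i))) := fun i => by
    have hsq : Tendsto (fun y => ‖(H y).starProjection (b i) - (H x).starProjection (b i)‖ ^ 2)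
        l (𝓝 0) :=
      squeeze_zero (fun y => by positivity) (fun y => Finset.single_le_sum
        (f := fun j => ‖(H y).starProjection (b j) - (H x).starProjection (b j)‖ ^ 2)
        (fun j _ => by positivity) (Finset.mem_univ i)) hsum
    rw [tendsto_iff_norm_sub_tendsto_zero]
    simpa using hsq.sqrt
  rw [← b.sum_repr u]
  simp only [map_sum, map_smul]
  exact tendsto_finsetSum _ fun i _ => (hbasis i).const_smul _

end IsLscFamily

/-- The family of affine subspaces `v x + H x`, where `v x` is orthogonal to `H x`, is lower
semicontinuous: every point of a fiber is the limit of its projections to the neighboring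
fibers. -/
structure IsLscAffineFamily (H : Y → Submodule ℝ W) (v : Y → W) : Prop where
  mem_orthogonal : ∀ x, v x ∈ (H x)ᗮ
  tendsto_affineProj : ∀ x p, p - v x ∈ H x →
    Tendsto (fun y => affineProj (H y) (v y) p) (𝓝 x) (𝓝 p)

namespace IsLscAffineFamily

theorem isLscFamily (hv : IsLscAffineFamily H v) : IsLscFamily H := fun x h hh => by
  have hvh := hv.tendsto_affineProj x (v x + h) (by rwa [add_sub_cancel_left])
  have hvx := hv.tendsto_affineProj x (v x) (by rw [sub_self]; exact zero_mem _)
  simpa [affineProj] using hvh.sub hvx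

theorem tendsto_of_finrank_le (hv : IsLscAffineFamily H v) (hl : l ≤ 𝓝 x)
    (hrank : ∀ᶠ y in l, finrank ℝ (H y) ≤ finrank ℝ (H x)) : Tendsto v l (𝓝 (v x)) := by
  have hproj := (hv.tendsto_affineProj x (v x) (by rw [sub_self]; exact zero_mem _)).mono_left hl
  have hzero := hv.isLscFamily.tendsto_starProjection hl hrank (v x)
  rw [(H x).starProjection_apply_eq_zero_iff.2 (hv.mem_orthogonal x)] at hzero
  simpa [affineProj] using hproj.sub hzero

theorem tendsto_affineProj_of_finrank_le (hv : IsLscAffineFamily H v) (hl : l ≤ 𝓝 x)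
    (hrank : ∀ᶠ y in l, finrank ℝ (H y) ≤ finrank ℝ (H x)) (p : W) :
    Tendsto (fun y => affineProj (H y) (v y) p) l (𝓝 (affineProj (H x) (v x) p)) :=
  (hv.tendsto_of_finrank_le hl hrank).add (hv.isLscFamily.tendsto_starProjection hl hrank p)

theorem continuousOn_affineProj (hv : IsLscAffineFamily H v) {F : Y → W} {k : ℕ}
    (hF : ContinuousOn F {x | finrank ℝ (H x) < k + 1})
    (hmem : ∀ x, finrank ℝ (H x) < k → F x - v x ∈ H x) :
    ContinuousOn (fun x => affineProj (H x) (v x) (F x)) {x | finrank ℝ (H x) < k + 1} := by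
  intro x hx
  suffices hlim : Tendsto (fun y => affineProj (H y) (v y) (F x))
      (𝓝[{x | finrank ℝ (H x) < k + 1}] x) (𝓝 (affineProj (H x) (v x) (F x))) from
    hlim.congr_dist <| squeeze_zero (fun _ => dist_nonneg)
      (fun y => dist_affineProj_affineProj_le (H y) (v y) (F x) (F y))
      (by simpa [dist_comm] using tendsto_iff_dist_tendsto_zero.1 (hF x hx))
  rcases (Nat.lt_succ_iff.1 hx).lt_or_eq with hlt | heq
  · rw [affineProj_eq_self (hv.mem_orthogonal x) (hmem x hlt)]
    exact (hv.tendsto_affineProj x _ (hmem x hlt)).mono_left nhdsWithin_le_nhds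
  · refine hv.tendsto_affineProj_of_finrank_le nhdsWithin_le_nhds ?_ (F x)
    filter_upwards [self_mem_nhdsWithin] with y hy
    exact heq ▸ Nat.lt_succ_iff.1 hy

end IsLscAffineFamily

end Lsc

section Depth

variable {Y M M' M'' : Type*} {d e : ℕ}

/-- A function of families `(v y)` has depth at most `d` if it depends on at most `d` of the
values `v y`. -/
def HasDepth (d : ℕ) (T : (Y → M) → M') : Prop :=
  ∃ S : Finset Y, #S ≤ d ∧ DependsOn T S

namespace HasDepth

theorem const (c : M') : HasDepth 0 fun _ : Y → M => c :=
  ⟨∅, le_rfl, fun _ _ _ => rfl⟩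

theorem eval (y : Y) : HasDepth 1 fun v : Y → M => v y :=
  ⟨{y}, by simp, fun _ _ h => h y (by simp)⟩

theorem mono {T : (Y → M) → M'} (hT : HasDepth d T) (hde : d ≤ e) : HasDepth e T :=
  hT.imp fun _ hS => ⟨hS.1.trans hde, hS.2⟩

theorem map₂ {T U : (Y → M) → M'} (hT : HasDepth d T) (hU : HasDepth e U) (f : M' → M' → M'') :
    HasDepth (d + e) fun v => f (T v) (U v) := by
  classical
  obtain ⟨S, hS, hT⟩ := hT
  obtain ⟨S', hS', hU⟩ := hU
  refine ⟨S ∪ S', (Finset.card_union_le S S').trans (add_le_add hS hS'), fun v v' h => ?_⟩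
  exact congr_arg₂ f (hT fun y hy => h y (Finset.mem_union_left S' hy))
    (hU fun y hy => h y (Finset.mem_union_right S hy))

variable {R : Type*} [Semiring R]

theorem linearCombination [AddCommMonoid M'] [Module R M'] {ι : Type*} {T : ι → (Y → M) → M'}
    (hT : ∀ i, HasDepth d (T i)) (w : ι →₀ R) :
    HasDepth (#w.support * d) fun v => Finsupp.linearCombination R (fun i => T i v) w := by
  classical
  choose S hS hT using hT
  refine ⟨w.support.biUnion S, Finset.card_biUnion_le_card_mul _ _ _ fun i _ => hS i,
    fun v v' h => Finset.sum_congr rfl fun i hi => ?_⟩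
  simp only [hT i fun y hy => h y (Finset.mem_biUnion.2 ⟨i, hi, hy⟩)]

theorem exists_eq_sum [AddCommMonoid M] [Module R M] [AddCommMonoid M'] [Module R M']
    {T : (Y → M) →ₗ[R] M'} (hT : HasDepth d T) :
    ∃ (S : Finset Y) (A : Y → M →ₗ[R] M'), #S ≤ d ∧ ∀ v, T v = ∑ y ∈ S, A y (v y) := by
  classical
  obtain ⟨S, hS, hT⟩ := hT
  refine ⟨S, fun y => T ∘ₗ LinearMap.single R (fun _ => M) y, hS, fun v => ?_⟩
  have hagree : ∀ y ∈ S, v y = (∑ z ∈ S, Pi.single z (v z)) y := fun y hy => by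
    rw [Finset.sum_apply, Finset.sum_pi_single, if_pos hy]
  rw [hT hagree, map_sum]
  rfl

end HasDepth

end Depth

section SectionOperators

variable {Y W : Type*} [NormedAddCommGroup W] [InnerProductSpace ℝ W] [FiniteDimensional ℝ W]
variable {H : Y → Submodule ℝ W} {d N : ℕ}

/-- `T` assigns to a lower semicontinuous family `v x + H x`, linearly in `v`, a continuous
selection over `E` which is bounded by `K` times any bound of `v`. -/
def IsSectionOperatorOn [TopologicalSpace Y] (H : Y → Submodule ℝ W) (E : Set Y) (K : ℝ)
    (T : Y → (Y → W) →ₗ[ℝ] W) : Prop :=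
  ∀ v, IsLscAffineFamily H v →
    ContinuousOn (fun x => T x v) E ∧ (∀ x ∈ E, T x v - v x ∈ H x) ∧
      ∀ B, (∀ x, ‖v x‖ ≤ B) → ∀ x ∈ E, ‖T x v‖ ≤ K * B

/-- The extension of a section operator `T` over the points with fibers of dimension less than `k`
to those with fibers of dimension `k`: average the values of `T` with the weights `w` and project
the result to the fiber. -/
noncomputable def extendSectionOperator (H : Y → Submodule ℝ W) (w : Y → Y →₀ ℝ)
    (T : Y → (Y → W) →ₗ[ℝ] W) (x : Y) : (Y → W) →ₗ[ℝ] W :=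
  LinearMap.proj x + ((H x).starProjection : W →ₗ[ℝ] W) ∘ₗ Finsupp.linearCombination ℝ T (w x)

theorem extendSectionOperator_apply (w : Y → Y →₀ ℝ) (T : Y → (Y → W) →ₗ[ℝ] W) (x : Y)
    (v : Y → W) :
    extendSectionOperator H w T x v =
      affineProj (H x) (v x) (Finsupp.linearCombination ℝ (fun y => T y v) (w x)) := by
  have happly : Finsupp.linearCombination ℝ T (w x) v =
      Finsupp.linearCombination ℝ (fun y => T y v) (w x) :=
    Finsupp.apply_linearCombination ℝ (LinearMap.applyₗ v) T (w x)
  simp [extendSectionOperator, affineProj, happly]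

theorem hasDepth_extendSectionOperator {w : Y → Y →₀ ℝ} {x : Y} (hw : #(w x).support ≤ N)
    {T : Y → (Y → W) →ₗ[ℝ] W} (hT : ∀ y, HasDepth d (T y)) :
    HasDepth (N * d + 1) (extendSectionOperator H w T x) := by
  have hdepth := ((HasDepth.linearCombination hT (w x)).mono (Nat.mul_le_mul_right d hw)).map₂
    (HasDepth.eval x) fun p u => affineProj (H x) u p
  exact (funext (extendSectionOperator_apply (H := H) w T x)) ▸ hdepth

theorem IsSectionOperatorOn.extend [TopologicalSpace Y] {k : ℕ} {K : ℝ} (hK : 0 ≤ K)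
    {T : Y → (Y → W) →ₗ[ℝ] W} (hT : IsSectionOperatorOn H {x | finrank ℝ (H x) < k} K T)
    {w : Y → Y →₀ ℝ} (hw : ∀ x, finrank ℝ (H x) < k → w x = Finsupp.single x 1)
    (hcont : ∀ g : Y → W, ContinuousOn g {x | finrank ℝ (H x) < k} →
      Continuous fun x => Finsupp.linearCombination ℝ g (w x))
    (hbound : ∀ (g : Y → W) (B : ℝ), 0 ≤ B → (∀ x, finrank ℝ (H x) < k → ‖g x‖ ≤ B) →
      ∀ x, ‖Finsupp.linearCombination ℝ g (w x)‖ ≤ B) :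
    IsSectionOperatorOn H {x | finrank ℝ (H x) < k + 1} (K + 1) (extendSectionOperator H w T) := by
  intro v hv
  obtain ⟨hTcont, hTmem, hTbound⟩ := hT v hv
  simp only [extendSectionOperator_apply]
  refine ⟨?_, fun x _ => affineProj_sub_mem, fun B hB x _ => ?_⟩
  · refine hv.continuousOn_affineProj (hcont _ hTcont).continuousOn fun x hx => ?_
    rw [hw x hx, Finsupp.linearCombination_single, one_smul]
    exact hTmem x hx
  · have hB0 : 0 ≤ B := (norm_nonneg _).trans (hB x)
    set p := Finsupp.linearCombination ℝ (fun y => T y v) (w x)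
    calc ‖affineProj (H x) (v x) p‖
      _ ≤ ‖v x‖ + ‖(H x).starProjection p‖ := norm_add_le _ _
      _ ≤ ‖v x‖ + ‖p‖ := by gcongr; exact (H x).norm_starProjection_apply_le p
      _ ≤ B + K * B := add_le_add (hB x) (hbound _ _ (mul_nonneg hK hB0) (hTbound B hB) x)
      _ = (K + 1) * B := by ring

variable [PseudoMetricSpace Y]

theorem IsDoublingWith.exists_isSectionOperatorOn (hY : IsDoublingWith Y N) (hH : IsLscFamily H)
    (k : ℕ) :
    ∃ T : Y → (Y → W) →ₗ[ℝ] W, IsSectionOperatorOn H {x | finrank ℝ (H x) < k} k T ∧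
      ∀ x, HasDepth (∑ i ∈ Finset.range k, N ^ i) (T x) := by
  induction k with
  | zero => exact ⟨0, fun v _ => by simp, fun _ => HasDepth.const 0⟩
  | succ k ih =>
    obtain ⟨T, hT, hdepth⟩ := ih
    obtain ⟨w, hcard, hsingle, hcont, hbound⟩ := hY.exists_weights W (hH.isClosed_finrank_lt k)
    refine ⟨extendSectionOperator H w T, ?_, fun x => ?_⟩
    · rw [Nat.cast_succ]
      exact hT.extend k.cast_nonneg hsingle hcont hbound
    · rw [geom_sum_succ]
      exact hasDepth_extendSectionOperator (hcard x) hdepth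

theorem IsDoublingWith.exists_isSectionOperatorOn_univ (hY : IsDoublingWith Y N)
    (H : Y → Submodule ℝ W) :
    ∃ T : Y → (Y → W) →ₗ[ℝ] W, IsSectionOperatorOn H Set.univ (finrank ℝ W + 1 : ℕ) T ∧
      ∀ x, HasDepth (∑ i ∈ Finset.range (finrank ℝ W + 1), N ^ i) (T x) := by
  by_cases hH : IsLscFamily H
  · have huniv : {x | finrank ℝ (H x) < finrank ℝ W + 1} = Set.univ :=
      Set.eq_univ_of_forall fun x => Nat.lt_succ_of_le (H x).finrank_le
    exact huniv ▸ hY.exists_isSectionOperatorOn hH (finrank ℝ W + 1)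
  · exact ⟨0, fun v hv => absurd hv.isLscFamily hH,
      fun _ => (HasDepth.const 0).mono (Nat.zero_le _)⟩

end SectionOperators

namespace SingularAffineBundle

variable {X : Type*} {r : ℕ} {H₀ : HomogeneousBundle X r} {v : X → EuclideanSpace ℝ (Fin r)}

theorem mem_translate_iff {x : X} {p : EuclideanSpace ℝ (Fin r)} :
    p ∈ translate v H₀ x ↔ p - v x ∈ H₀ x :=
  AffineSubspace.mem_mk'

theorem IsGlaeserStable.isLscAffineFamily [TopologicalSpace X]
    (hstable : (translate v H₀).IsGlaeserStable) (hv : ∀ x, v x ∈ (H₀ x)ᗮ) :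
    IsLscAffineFamily H₀ v := by
  refine ⟨hv, fun x p hp => ?_⟩
  have hmem : p ∈ (translate v H₀).glaeserRefinement x := by
    rw [hstable]
    exact mem_translate_iff.2 hp
  refine tendsto_iff_edist_tendsto_0.2 <| tendsto_of_tendsto_of_tendsto_of_le_of_le
    tendsto_const_nhds hmem.2 (fun _ => zero_le) fun y => le_infEDist.2 fun q hq => ?_
  rw [edist_comm, edist_dist, edist_dist]
  exact ENNReal.ofReal_le_ofReal (dist_self_affineProj_le (hv y) (mem_translate_iff.1 hq) p)

end SingularAffineBundle

theorem isCompact_closedCube {n : ℕ} (c : EuclideanSpace ℝ (Fin n)) (δ : ℝ) :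
    IsCompact (closedCube c δ) := by
  have hpreimage : closedCube c δ = (EuclideanSpace.equiv (Fin n) ℝ).toHomeomorph ⁻¹'
      Set.univ.pi fun i => closedBall (c i) (δ / 2) := by
    ext x
    simp [closedCube, Real.dist_eq]
  rw [hpreimage, Homeomorph.isCompact_preimage]
  exact isCompact_univ_pi fun i => isCompact_closedBall _ _

instance compactSpace_closedCube {n : ℕ} (c : EuclideanSpace ℝ (Fin n)) (δ : ℝ) :
    CompactSpace (closedCube c δ) :=
  isCompact_iff_compactSpace.1 (isCompact_closedCube c δ)

theorem isDoublingWith_closedCube {n : ℕ} (c : EuclideanSpace ℝ (Fin n)) (δ : ℝ) :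
    IsDoublingWith (closedCube c δ) (5 ^ n) := by
  have := isDoublingWith_five_pow_finrank (EuclideanSpace ℝ (Fin n))
  rw [finrank_euclideanSpace_fin] at this
  exact this.subtype _

theorem theorem3_general (N r : ℕ) :
    ∃ (C : ℝ) (d : ℕ),
      ∀ (X : Type*) [PseudoMetricSpace X] [CompactSpace X], IsDoublingWith X N →
      ∀ H₀ : HomogeneousBundle X r,
      ∃ (S : X → Finset X)
        (A : X → X → (EuclideanSpace ℝ (Fin r) →ₗ[ℝ] EuclideanSpace ℝ (Fin r))),
        (∀ x, (S x).card ≤ d) ∧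
        ∀ v : X → EuclideanSpace ℝ (Fin r),
          (∀ x, v x ∈ (H₀ x)ᗮ) →
          (SingularAffineBundle.translate v H₀).IsGlaeserStable →
          (SingularAffineBundle.translate v H₀).IsSection
              (fun x => ∑ y ∈ S x, A x y (v y)) ∧
            BddAbove (Set.range fun y => ‖v y‖) ∧
            ∀ x, ‖∑ y ∈ S x, A x y (v y)‖ ≤ C * ⨆ y, ‖v y‖ := by
  refine ⟨(r + 1 : ℕ), ∑ i ∈ Finset.range (r + 1), N ^ i, fun X _ _ hX H₀ => ?_⟩
  obtain ⟨T, hT, hdepth⟩ := hX.exists_isSectionOperatorOn_univ H₀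
  rw [finrank_euclideanSpace_fin] at hT hdepth
  choose S A hS hA using fun x => (hdepth x).exists_eq_sum
  refine ⟨S, A, hS, fun v hv hstable => ?_⟩
  obtain ⟨hcont, hmem, hbound⟩ := hT v (hstable.isLscAffineFamily hv)
  have hcont : Continuous fun x => T x v := continuousOn_univ.1 hcont
  have hbdd : BddAbove (Set.range fun y => ‖v y‖) :=
    (isCompact_range hcont.norm).bddAbove.range_mono _ fun x =>
      norm_le_of_sub_mem (hv x) (hmem x (Set.mem_univ x))
  simp only [← hA]
  exact ⟨⟨hcont, fun x => SingularAffineBundle.mem_translate_iff.2 (hmem x (Set.mem_univ x))⟩, hbdd,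
    fun x => hbound _ (le_ciSup hbdd) x (Set.mem_univ x)⟩

theorem theorem3 (n r : ℕ) (hn : 0 < n) (hr : 0 < r) :
    ∃ (C : ℝ) (d : ℕ),
      ∀ (c : EuclideanSpace ℝ (Fin n)) (δ : ℝ), 0 < δ →
      ∀ H₀ : HomogeneousBundle (closedCube c δ) r,
      ∃ (S : closedCube c δ → Finset (closedCube c δ))
        (A : closedCube c δ → closedCube c δ →
          (EuclideanSpace ℝ (Fin r) →ₗ[ℝ] EuclideanSpace ℝ (Fin r))),
        (∀ x, (S x).card ≤ d) ∧
        ∀ v : closedCube c δ → EuclideanSpace ℝ (Fin r),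
          (∀ x, v x ∈ (H₀ x)ᗮ) →
          (SingularAffineBundle.translate v H₀).IsGlaeserStable →
          (SingularAffineBundle.translate v H₀).IsSection
              (fun x => ∑ y ∈ S x, A x y (v y)) ∧
            BddAbove (Set.range fun y => ‖v y‖) ∧
            ∀ x, ‖∑ y ∈ S x, A x y (v y)‖ ≤ C * ⨆ y, ‖v y‖ := by
  obtain ⟨C, d, h⟩ := theorem3_general (5 ^ n) r
  exact ⟨C, d, fun c δ _ => h (closedCube c δ) (isDoublingWith_closedCube c δ)⟩
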